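/- Let $p>3$ be a prime and let $\mathbb Z_p$ be the ring of $p$-adic integers. For $n\in\{0,1,2,\dots\}$ and $x\in\mathbb Z_p$ put $$s_n(x)=\sum_{k=0}^{n}\binom nk\binom xk\binom{x+k}k,\qquad \binom xk=\frac{x(x-1)\cdots(x-k+1)}{k!},$$ and let $\langle x\rangle_p$ denote the least nonnegative integer $r$ with $x\equiv r\pmod p$. For $p$-adic numbers $a,b$, write $a\equiv b\pmod{p^m}$ if $a-b\in p^m\mathbb Z_p$. Then: (1) For every $x\in\mathbb Z_p$ with $x\not\equiv-\tfrac12\pmod p$, $$\sum_{k=0}^{p-1}s_k(x)^2\equiv(-1)^{\langle x\rangle_p}\,\frac{p+2(x-\langle x\rangle_p)}{2x+1}\pmod{p^2}.$$ (2) For every $x\in\{0,1,\dots,p-1\}$ (including $x=(p-1)/2$, where the right-hand side equals $(-1)^{(p-1)/2}$), $$\sum_{k=0}^{p-1}s_k(x)^2\equiv\frac{(-1)^x\,p}{2x+1}\pmod{p^3}.$$ (3) For every $x\in\mathbb Z_p$, $$\sum_{k=0}^{p-1}(2k+1)\,s_k(x)^2\equiv0\pmod{p^2}.$$ -/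

import Mathlib

/-- The polynomials `s_n(x) = ∑_{k=0}^n C(n,k) C(x,k) C(x+k,k)`, evaluated in a commutative ring
in which binomial coefficients `C(x,k) = x(x-1)⋯(x-k+1)/k!` make sense (such as `ℤ_[p]`). -/
noncomputable def sPoly {R : Type*} [CommRing R] [BinomialRing R] (n : ℕ) (x : R) : R :=
  ∑ k ∈ Finset.range (n + 1), (n.choose k : R) * Ring.choose x k * Ring.choose (x + (k : R)) k

/-- The congruence `a ≡ b (mod p^m)` for `p`-adic numbers: `a - b ∈ p^m ℤ_p`. -/
def PadicCongr (p : ℕ) [Fact p.Prime] (m : ℕ) (a b : ℚ_[p]) : Prop :=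
  ∃ z : ℤ_[p], a - b = (p : ℚ_[p]) ^ m * (z : ℚ_[p])

/-- `⟨x⟩_p`, the least `r ∈ ℕ` with `x ≡ r (mod p)`. -/
noncomputable def leastResidue (p : ℕ) [Fact p.Prime] (x : ℤ_[p]) : ℕ :=
  sInf {r : ℕ | PadicCongr p 1 (x : ℚ_[p]) (r : ℚ_[p])}

/-!
Write `h(x, N) = ∑_{n<N} s_n(x)²`. The numbers `s_n(x)` satisfy two three-term recurrences:

* in `n` (`sPoly_difference`), they are an eigenvector of a difference operator with eigenvalue
  `x(x+1)`, so `christoffel_darboux` evaluates `(x(x+1) - y(y+1)) ∑_{n<N} s_n(x) s_n(y)` as `N²`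
  times a boundary term;
* in `x` (`sPoly_three_term`), they satisfy an analogue of Bonnet's recursion for the Legendre
  polynomials, with multiplication by `2n+1` in place of multiplication by the variable.

For an integer `0 ≤ x < p`, `s_n(x)` is a polynomial in `n` with `p`-integral coefficients, with
value `1` at `n = 0` and `(-1)^x` at `n = -1`. The boundary term for the pair `x, x+2` therefore
vanishes at `N = 0`, and `2x+3` can be cancelled from it because it divides `s_n(x+2) - s_n(x)`.
Hence `∑_{n<N} s_n(x) s_n(x+2)` is `N³` times an integral polynomial
(`exists_polynomial_sum_mul`). As for orthogonal polynomials in general, Bonnet's recursion and this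
near-orthogonality give the norms: `(2x+1) h(x, N) = (-1)^x N + N³ Q(N)` with `Q` integral
(`exists_polynomial_sum_sq`). At `N = p` this is the congruence modulo `p³`, except that for
`2x+1 = p` a factor `p` is lost. In that case `(2x+1) h(x, N)` vanishes modulo `p` for all `N`, which
forces `Q` to be `-(-1)^x X^(p-3)` modulo `p`, so that `p` divides `Q(p)` (`dvd_eval_error`); this
is where `p > 3` enters. The sum weighted by `2n+1` is a difference of two Christoffel--Darboux sums
(`sum_weighted_sq`).

For general `x = r + pt`, both sums are integral polynomials in `x(x+1)`. Since `x(x+1)` is invariant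
under `x ↦ -1-x`, the values at `r` and at `p-1-r` determine the first-order Taylor expansion at `r`
modulo `p²` (`eval_congr_of_reflection`), and the case of integers suffices.
-/

/-! ### Binomial coefficients in a binomial ring -/

section BinomialRing

variable {R : Type*} [CommRing R] [BinomialRing R]

theorem succ_mul_choose_succ (x : R) (k : ℕ) :
    ((k : R) + 1) * Ring.choose x (k + 1) = (x - k) * Ring.choose x k := by
  have h := Ring.choose_smul_choose x (Nat.le_succ k)
  simp only [Nat.succ_eq_add_one, Nat.choose_succ_self_right, nsmul_eq_mul, Nat.cast_add,
    Nat.cast_one, Nat.add_sub_cancel_left, Ring.choose_one_right] at h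
  rw [h, mul_comm]

theorem succ_mul_choose_add_one_succ (x : R) (k : ℕ) :
    ((k : R) + 1) * Ring.choose (x + 1) (k + 1) = (x + 1) * Ring.choose x k := by
  have h := Ring.choose_smul_choose (x + 1) (Nat.le_add_left 1 k)
  simpa only [Nat.choose_one_right, nsmul_eq_mul, Nat.cast_add, Nat.cast_one,
    Nat.add_sub_cancel, Ring.choose_one_right, add_sub_cancel_right] using h

theorem sub_mul_choose_add_one (x : R) (k : ℕ) :
    (x + 1 - k) * Ring.choose (x + 1) k = (x + 1) * Ring.choose x k := by
  rw [← succ_mul_choose_succ, succ_mul_choose_add_one_succ]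

/-- The coefficient `C(x,k) C(x+k,k)` of `C(n,k)` in `s_n(x)`; these are also the coefficients of
the Legendre function `P_x(1 + 2t)` as a power series in `t`. -/
noncomputable def legendreCoeff (k : ℕ) (x : R) : R :=
  Ring.choose x k * Ring.choose (x + k) k

theorem sPoly_eq_sum (n : ℕ) (x : R) :
    sPoly n x = ∑ k ∈ Finset.range (n + 1), (n.choose k : R) * legendreCoeff k x := by
  simp only [sPoly, legendreCoeff, mul_assoc]

theorem sPoly_eq_sum_of_lt {n M : ℕ} (h : n < M) (x : R) :
    sPoly n x = ∑ k ∈ Finset.range M, (n.choose k : R) * legendreCoeff k x := by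
  rw [sPoly_eq_sum]
  refine Finset.sum_subset (Finset.range_mono h) fun k _ hk => ?_
  rw [Nat.choose_eq_zero_of_lt (by simpa using hk), Nat.cast_zero, zero_mul]

@[simp]
theorem legendreCoeff_zero (x : R) : legendreCoeff 0 x = 1 := by
  simp [legendreCoeff]

theorem sq_mul_legendreCoeff_succ (x : R) (k : ℕ) :
    ((k : R) + 1) ^ 2 * legendreCoeff (k + 1) x = (x - k) * (x + k + 1) * legendreCoeff k x := by
  have h₁ := succ_mul_choose_succ x k
  have h₂ := succ_mul_choose_add_one_succ (x + k) k
  simp only [legendreCoeff]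
  push_cast
  rw [← add_assoc]
  linear_combination ((k : R) + 1) * Ring.choose (x + k + 1) (k + 1) * h₁ +
    (x - k) * Ring.choose x k * h₂

theorem sq_mul_legendreCoeff_succ_add_one (x : R) (k : ℕ) :
    ((k : R) + 1) ^ 2 * legendreCoeff (k + 1) (x + 1) =
      (x + k + 1) * (x + k + 2) * legendreCoeff k x := by
  have h₁ := succ_mul_choose_add_one_succ x k
  have h₂ := succ_mul_choose_add_one_succ (x + k + 1) k
  have h₃ := sub_mul_choose_add_one (x + k) k
  simp only [legendreCoeff]
  push_cast
  rw [show x + 1 + ((k : R) + 1) = x + k + 1 + 1 by ring]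
  linear_combination ((k : R) + 1) * Ring.choose (x + k + 1 + 1) (k + 1) * h₁ +
    (x + 1) * Ring.choose x k * h₂ + (x + k + 2) * Ring.choose x k * h₃

theorem sq_mul_legendreCoeff_succ_sub_one (x : R) (k : ℕ) :
    ((k : R) + 1) ^ 2 * legendreCoeff (k + 1) x =
      (x + 1 - k) * (x - k) * legendreCoeff k (x + 1) := by
  have h₁ := succ_mul_choose_succ x k
  have h₂ := succ_mul_choose_succ (x + k + 1) k
  have h₃ := sub_mul_choose_add_one x k
  simp only [legendreCoeff]
  push_cast
  rw [← add_assoc, show x + 1 + (k : R) = x + k + 1 by ring]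
  linear_combination ((k : R) + 1) * Ring.choose (x + k + 1) (k + 1) * h₁ +
    (x - k) * Ring.choose x k * h₂ - (x - k) * Ring.choose (x + k + 1) k * h₃

theorem succ_mul_legendreCoeff_sub [IsDomain R] [CharZero R] (x : R) (k : ℕ) :
    ((k : R) + 1) * (legendreCoeff (k + 1) (x + 2) - legendreCoeff (k + 1) x) =
      2 * (2 * x + 3) * legendreCoeff k (x + 1) := by
  have h₁ := sq_mul_legendreCoeff_succ_add_one (x + 1) k
  have h₂ := sq_mul_legendreCoeff_succ_sub_one x k
  rw [show x + 1 + 1 = x + 2 by ring] at h₁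
  refine mul_left_cancel₀ (Nat.cast_add_one_ne_zero k) ?_
  linear_combination h₁ - h₂

/-- The coefficientwise form of the three-term recurrence in `x`. -/
theorem legendreCoeff_three_term [IsDomain R] [CharZero R] (x : R) (k : ℕ) :
    (x + 2) ^ 2 * legendreCoeff (k + 1) (x + 2) =
      (2 * x + 3) * ((2 * k + 3) * legendreCoeff (k + 1) (x + 1) +
        2 * (k + 1) * legendreCoeff k (x + 1)) + (x + 1) ^ 2 * legendreCoeff (k + 1) x := by
  have h₀ := sq_mul_legendreCoeff_succ (x + 1) k
  have h₁ := sq_mul_legendreCoeff_succ_add_one (x + 1) k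
  have h₂ := sq_mul_legendreCoeff_succ_sub_one x k
  rw [show x + 1 + 1 = x + 2 by ring] at h₁
  refine mul_left_cancel₀ (pow_ne_zero 2 (Nat.cast_add_one_ne_zero (R := R) k)) ?_
  linear_combination (x + 2) ^ 2 * h₁ - (2 * x + 3) * (2 * k + 3) * h₀ - (x + 1) ^ 2 * h₂

/-- The three-term recurrence in `x`, the analogue of Bonnet's recursion for the Legendre
polynomials. -/
theorem sPoly_three_term [IsDomain R] [CharZero R] (n : ℕ) (x : R) :
    (x + 2) ^ 2 * sPoly n (x + 2) =
      (2 * x + 3) * (2 * n + 1) * sPoly n (x + 1) + (x + 1) ^ 2 * sPoly n x := by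
  -- The partial sums telescope, and the boundary term vanishes at `M = n`.
  have key : ∀ M : ℕ, ∑ k ∈ Finset.range (M + 1), (n.choose k : R) *
      ((x + 2) ^ 2 * legendreCoeff k (x + 2) -
        (2 * x + 3) * (2 * n + 1) * legendreCoeff k (x + 1) - (x + 1) ^ 2 * legendreCoeff k x) =
      - (2 * x + 3) * 2 * (n - M) * n.choose M * legendreCoeff M (x + 1) := by
    intro M
    induction M with
    | zero =>
      simp
      ring
    | succ M ih =>
      rw [Finset.sum_range_succ, ih]
      have h := legendreCoeff_three_term x M
      have hc : (n.choose (M + 1) : R) * (M + 1) = n.choose M * (n - M) := by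
        have := succ_mul_choose_succ (n : R) M
        rw [Ring.choose_natCast, Ring.choose_natCast] at this
        linear_combination this
      push_cast
      linear_combination (n.choose (M + 1) : R) * h +
        (2 * x + 3) * 2 * legendreCoeff M (x + 1) * hc
  have h := key n
  simp only [sPoly_eq_sum]
  rw [sub_self, mul_zero, zero_mul, zero_mul] at h
  simp only [mul_sub, Finset.sum_sub_distrib] at h
  simp only [Finset.mul_sum]
  rw [← sub_eq_zero, ← sub_sub, ← h]
  congr 1
  · congr 1 <;> exact Finset.sum_congr rfl fun k _ => by ring
  · exact Finset.sum_congr rfl fun k _ => by ring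

/-- For fixed `x`, the sequence `s_n(x)` is an eigenvector of a second order difference operator in
`n`, with eigenvalue `x(x+1)`. -/
theorem sPoly_difference (n : ℕ) (x : R) :
    ((n : R) + 2) ^ 2 * (sPoly (n + 2) x - sPoly (n + 1) x) =
      ((n : R) + 1) ^ 2 * (sPoly (n + 1) x - sPoly n x) + x * (x + 1) * sPoly (n + 1) x := by
  -- The partial sums telescope, and the boundary term vanishes at `M = n + 2`.
  have key : ∀ M : ℕ, ∑ k ∈ Finset.range (M + 1), legendreCoeff k x *
      (((n : R) + 2) ^ 2 * ((n + 2).choose k - (n + 1).choose k) -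
        ((n : R) + 1) ^ 2 * ((n + 1).choose k - n.choose k) - x * (x + 1) * (n + 1).choose k) =
      - ((M : R) + 1) ^ 2 * (n + 1).choose M * legendreCoeff (M + 1) x := by
    intro M
    induction M with
    | zero =>
      have := sq_mul_legendreCoeff_succ x 0
      simp at this ⊢
      linear_combination -this
    | succ M ih =>
      rw [Finset.sum_range_succ, ih]
      have h := sq_mul_legendreCoeff_succ x (M + 1)
      have e₁ : ((n + 2).choose (M + 1) : R) = (n + 1).choose M + (n + 1).choose (M + 1) := by
        exact_mod_cast congrArg (Nat.cast (R := R)) (Nat.choose_succ_succ (n + 1) M)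
      have e₂ : ((n + 1).choose (M + 1) : R) = n.choose M + n.choose (M + 1) := by
        exact_mod_cast congrArg (Nat.cast (R := R)) (Nat.choose_succ_succ n M)
      have c₁ : ((M : R) + 1) * (n + 1).choose (M + 1) = (n + 1) * n.choose M := by
        exact_mod_cast congrArg (Nat.cast (R := R))
          ((mul_comm _ _).trans (Nat.add_one_mul_choose_eq n M).symm)
      have c₂ : ((M : R) + 1) * (n + 2).choose (M + 1) = (n + 2) * (n + 1).choose M := by
        exact_mod_cast congrArg (Nat.cast (R := R))
          ((mul_comm _ _).trans (Nat.add_one_mul_choose_eq (n + 1) M).symm)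
      push_cast at h ⊢
      linear_combination (n + 1).choose (M + 1) * h +
        legendreCoeff (M + 1) x * (((n : R) + 2) ^ 2 * e₁ - ((n : R) + 1) ^ 2 * e₂ -
          (n + M + 3) * c₂ + (n + 1) * c₁ + ((M : R) + 1) * (n + M + 3) * e₁)
  have h := key (n + 2)
  rw [Nat.choose_eq_zero_of_lt (by omega : n + 1 < n + 2), Nat.cast_zero, mul_zero, zero_mul] at h
  rw [sPoly_eq_sum, sPoly_eq_sum_of_lt (by omega : n + 1 < n + 2 + 1),
    sPoly_eq_sum_of_lt (by omega : n < n + 2 + 1), ← sub_eq_zero, ← h]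
  simp only [← Finset.sum_sub_distrib, ← Finset.sum_add_distrib, Finset.mul_sum]
  exact Finset.sum_congr rfl fun k _ => by ring

@[simp]
theorem sPoly_zero_left (x : R) : sPoly 0 x = 1 := by
  simp [sPoly_eq_sum]

theorem sPoly_one_left (x : R) : sPoly 1 x = 1 + x * (x + 1) := by
  have := sq_mul_legendreCoeff_succ x 0
  simp at this
  simp [sPoly_eq_sum, Finset.sum_range_succ, this]

@[simp]
theorem sPoly_zero_right (n : ℕ) : sPoly n (0 : R) = 1 := by
  rw [sPoly_eq_sum, Finset.sum_range_succ']
  simp [legendreCoeff]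

theorem sPoly_one_right [IsDomain R] [CharZero R] (n : ℕ) : sPoly n (1 : R) = 2 * n + 1 := by
  -- At `x = -1` the last term of the recurrence drops out.
  have h := sPoly_three_term n (-1 : R)
  rw [show (-1 + 2 : R) = 1 by norm_num, show (-1 + 1 : R) = 0 by norm_num, sPoly_zero_right] at h
  linear_combination h

/-- The Christoffel--Darboux formula for the orthogonal polynomials `s_n` in the variable
`x(x+1)`. -/
theorem christoffel_darboux (N : ℕ) (x y : R) :
    (x * (x + 1) - y * (y + 1)) * ∑ n ∈ Finset.range (N + 1), sPoly n x * sPoly n y =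
      ((N : R) + 1) ^ 2 *
        (sPoly (N + 1) x * sPoly N y - sPoly N x * sPoly (N + 1) y) := by
  induction N with
  | zero => simp [sPoly_one_left]
  | succ N ih =>
    rw [Finset.sum_range_succ, mul_add, ih]
    have h₁ := sPoly_difference N x
    have h₂ := sPoly_difference N y
    push_cast
    linear_combination sPoly (N + 1) x * h₂ - sPoly (N + 1) y * h₁

end BinomialRing

/-! ### Sums of products of neighbouring values -/

section Sums

variable {R : Type*} [CommRing R] [BinomialRing R] [IsDomain R] [CharZero R]

/-- Consecutive norms `∑ s_n(x)²` are linked through the products `s_n(x) s_n(x+2)`, which are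
nearly orthogonal. -/
theorem sum_sq_recurrence (N : ℕ) (x : R) :
    (x + 2) ^ 2 * ((2 * x + 5) * ∑ n ∈ Finset.range N, sPoly n (x + 2) ^ 2) =
      -(x + 2) ^ 2 * ((2 * x + 3) * ∑ n ∈ Finset.range N, sPoly n (x + 1) ^ 2) +
      (2 * x + 3) * (x + 3) ^ 2 * ∑ n ∈ Finset.range N, sPoly n (x + 1) * sPoly n (x + 3) +
      (2 * x + 5) * (x + 1) ^ 2 * ∑ n ∈ Finset.range N, sPoly n x * sPoly n (x + 2) := by
  simp only [Finset.mul_sum, ← Finset.sum_add_distrib]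
  refine Finset.sum_congr rfl fun n _ => ?_
  have h₁ := sPoly_three_term n x
  have h₂ := sPoly_three_term n (x + 1)
  rw [show x + 1 + 2 = x + 3 by ring, show x + 1 + 1 = x + 2 by ring] at h₂
  linear_combination (2 * x + 5) * sPoly n (x + 2) * h₁ - (2 * x + 3) * sPoly n (x + 1) * h₂

theorem sum_weighted_sq (N : ℕ) (x : R) :
    (2 * x + 3) * ∑ n ∈ Finset.range N, (2 * n + 1) * sPoly n (x + 1) ^ 2 =
      (x + 2) ^ 2 * ∑ n ∈ Finset.range N, sPoly n (x + 2) * sPoly n (x + 1) -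
      (x + 1) ^ 2 * ∑ n ∈ Finset.range N, sPoly n (x + 1) * sPoly n x := by
  simp only [Finset.mul_sum, ← Finset.sum_sub_distrib]
  refine Finset.sum_congr rfl fun n _ => ?_
  linear_combination -sPoly n (x + 1) * sPoly_three_term n x

end Sums

/-! ### Polynomiality in `n` -/

section Polynomial

open Polynomial

variable {p : ℕ} [Fact p.Prime]

theorem isUnit_natCast_of_pos_of_lt {k : ℕ} (h₀ : 0 < k) (h : k < p) : IsUnit (k : ℤ_[p]) := by
  rw [PadicInt.isUnit_iff, PadicInt.norm_natCast_eq_one_iff]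
  exact (Nat.coprime_of_lt_prime h₀.ne' h Fact.out)

theorem eq_of_forall_eval_natCast_eq {f g : ℤ_[p][X]}
    (h : ∀ n : ℕ, f.eval (n : ℤ_[p]) = g.eval (n : ℤ_[p])) : f = g := by
  refine eq_of_infinite_eval_eq f g ?_
  refine (Set.infinite_range_of_injective (Nat.cast_injective (R := ℤ_[p]))).mono ?_
  rintro _ ⟨n, rfl⟩
  exact h n

theorem exists_polynomial_choose {k : ℕ} (h : k < p) :
    ∃ β : ℤ_[p][X], β.natDegree ≤ k ∧ ∀ n : ℕ, β.eval (n : ℤ_[p]) = n.choose k := by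
  have hu : IsUnit (k.factorial : ℤ_[p]) := by
    rw [PadicInt.isUnit_iff, PadicInt.norm_natCast_eq_one_iff]
    exact ((Nat.Prime.coprime_iff_not_dvd Fact.out).2 fun hd =>
      absurd ((Nat.Prime.dvd_factorial Fact.out).1 hd) (by omega))
  obtain ⟨u, hu⟩ := hu.exists_left_inv
  refine ⟨C u * descPochhammer ℤ_[p] k, ?_, fun n => ?_⟩
  · exact (natDegree_C_mul_le _ _).trans (descPochhammer_natDegree _ k).le
  · rw [eval_mul, eval_C, descPochhammer_eval_eq_descFactorial,
      Nat.descFactorial_eq_factorial_mul_choose, Nat.cast_mul, ← mul_assoc, hu, one_mul]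

theorem legendreCoeff_natCast_eq_zero {x k : ℕ} (h : x < k) :
    legendreCoeff k (x : ℤ_[p]) = 0 := by
  rw [legendreCoeff, Ring.choose_natCast, Nat.choose_eq_zero_of_lt h, Nat.cast_zero, zero_mul]

theorem sPoly_natCast_right {x M : ℕ} (h : x < M) (n : ℕ) :
    sPoly n (x : ℤ_[p]) =
      ∑ k ∈ Finset.range M, (n.choose k : ℤ_[p]) * legendreCoeff k (x : ℤ_[p]) := by
  rw [sPoly_eq_sum_of_lt (by omega : n < n + M)]
  symm
  refine Finset.sum_subset (Finset.range_mono (by omega)) fun k _ hk => ?_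
  rw [legendreCoeff_natCast_eq_zero (by simp at hk; omega), mul_zero]

theorem exists_polynomial_sPoly {x : ℕ} (h : x < p) :
    ∃ P : ℤ_[p][X], P.natDegree ≤ x ∧ ∀ n : ℕ, P.eval (n : ℤ_[p]) = sPoly n (x : ℤ_[p]) := by
  have hβ : ∀ k : ℕ, ∃ β : ℤ_[p][X], k < p →
      β.natDegree ≤ k ∧ ∀ n : ℕ, β.eval (n : ℤ_[p]) = n.choose k := fun k => by
    by_cases hk : k < p
    · exact (exists_polynomial_choose hk).imp fun _ h _ => h
    · exact ⟨0, fun h => absurd h hk⟩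
  choose β hβ using hβ
  refine ⟨∑ k ∈ Finset.range (x + 1), β k * C (legendreCoeff k (x : ℤ_[p])), ?_, fun n => ?_⟩
  · refine natDegree_sum_le_of_forall_le _ _ fun k hk => ?_
    rw [Finset.mem_range] at hk
    exact ((natDegree_mul_C_le _ _).trans (hβ k (by omega)).1).trans (by omega)
  · rw [eval_finsetSum, sPoly_natCast_right (Nat.lt_succ_self x)]
    refine Finset.sum_congr rfl fun k hk => ?_
    rw [Finset.mem_range] at hk
    rw [eval_mul, eval_C, (hβ k (by omega)).2]

/-- The analogue of `P_{x+2}' - P_x' = (2x+3) P_{x+1}`: the difference `s_n(x+2) - s_n(x)` is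
divisible by `2x+3` as a polynomial in `n`. This matters when `2x+3` equals `p`. -/
theorem exists_polynomial_sPoly_sub {x : ℕ} (h : x + 2 < p) :
    ∃ ρ : ℤ_[p][X], ρ.natDegree ≤ x + 2 ∧ ∀ n : ℕ,
      sPoly n ((x : ℤ_[p]) + 2) - sPoly n (x : ℤ_[p]) =
        2 * (2 * x + 3) * ρ.eval (n : ℤ_[p]) := by
  have hβ : ∀ k : ℕ, ∃ β : ℤ_[p][X], k + 1 < p → β.natDegree ≤ k + 1 ∧
      ∀ n : ℕ, (k + 1) * β.eval (n : ℤ_[p]) = n.choose (k + 1) := fun k => by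
    by_cases hk : k + 1 < p
    · obtain ⟨β, hd, he⟩ := exists_polynomial_choose hk
      obtain ⟨u, hu⟩ := (isUnit_natCast_of_pos_of_lt k.succ_pos hk).exists_right_inv
      refine ⟨C u * β, fun _ => ⟨(natDegree_C_mul_le _ _).trans hd, fun n => ?_⟩⟩
      rw [eval_mul, eval_C, he, ← mul_assoc, ← Nat.cast_add_one, hu, one_mul]
    · exact ⟨0, fun h => absurd h hk⟩
  choose β hβ using hβ
  refine ⟨∑ k ∈ Finset.range (x + 2), β k * C (legendreCoeff k ((x : ℤ_[p]) + 1)), ?_,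
    fun n => ?_⟩
  · refine natDegree_sum_le_of_forall_le _ _ fun k hk => ?_
    rw [Finset.mem_range] at hk
    exact ((natDegree_mul_C_le _ _).trans (hβ k (by omega)).1).trans (by omega)
  · have h₂ : (x : ℤ_[p]) + 2 = ((x + 2 : ℕ) : ℤ_[p]) := by push_cast; ring
    rw [h₂, sPoly_natCast_right (by omega : x + 2 < x + 2 + 1),
      sPoly_natCast_right (by omega : x < x + 2 + 1), ← Finset.sum_sub_distrib,
      Finset.sum_range_succ', eval_finsetSum, Finset.mul_sum, ← h₂]
    simp only [legendreCoeff_zero, sub_self, add_zero]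
    refine Finset.sum_congr rfl fun k hk => ?_
    rw [Finset.mem_range] at hk
    rw [eval_mul, eval_C, ← (hβ k (by omega)).2]
    linear_combination (β k).eval (n : ℤ_[p]) * succ_mul_legendreCoeff_sub (x : ℤ_[p]) k

/-- The value at `n = -1` of the polynomial interpolating `n ↦ s_n(x)`. -/
theorem eval_neg_one_of_eval_eq_sPoly (x : ℕ) (h : x < p) (P : ℤ_[p][X])
    (hP : ∀ n : ℕ, P.eval (n : ℤ_[p]) = sPoly n (x : ℤ_[p])) : P.eval (-1) = (-1) ^ x := by
  induction x using Nat.twoStepInduction generalizing P with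
  | zero =>
    rw [eq_of_forall_eval_natCast_eq (f := P) (g := 1) fun n => by simp [hP]]
    simp
  | one =>
    rw [eq_of_forall_eval_natCast_eq (f := P) (g := 2 * X + 1) fun n => by
      simp [hP, sPoly_one_right]]
    norm_num
  | more x ih₀ ih₁ =>
    obtain ⟨P₀, -, h₀⟩ := exists_polynomial_sPoly (p := p) (x := x) (by omega)
    obtain ⟨P₁, -, h₁⟩ := exists_polynomial_sPoly (p := p) (x := x + 1) (by omega)
    have key : C (((x : ℤ_[p]) + 2) ^ 2) * P =
        C (2 * (x : ℤ_[p]) + 3) * (2 * X + 1) * P₁ + C (((x : ℤ_[p]) + 1) ^ 2) * P₀ := by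
      refine eq_of_forall_eval_natCast_eq fun n => ?_
      have := sPoly_three_term n (x : ℤ_[p])
      simp only [eval_add, eval_mul, eval_C, eval_X, eval_one, eval_ofNat, hP, h₀, h₁]
      push_cast
      exact this
    have hx : ((x : ℤ_[p]) + 2) ^ 2 ≠ 0 := by
      have : ((x + 2 : ℕ) : ℤ_[p]) ≠ 0 := Nat.cast_ne_zero.2 (by omega)
      exact pow_ne_zero 2 (by exact_mod_cast this)
    have e := congrArg (eval (-1)) key
    simp only [eval_add, eval_mul, eval_C, eval_X, eval_one, eval_ofNat,
      ih₀ (by omega) P₀ h₀, ih₁ (by omega) P₁ h₁] at e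
    refine mul_left_cancel₀ hx (e.trans ?_)
    ring

/-- Near-orthogonality of `s_n(x)` and `s_n(x+2)`. -/
theorem exists_polynomial_sum_mul {x : ℕ} (h : x + 2 < p) :
    ∃ D : ℤ_[p][X], D.natDegree ≤ 2 * x + 1 ∧ ∀ N : ℕ,
      ∑ n ∈ Finset.range N, sPoly n (x : ℤ_[p]) * sPoly n ((x : ℤ_[p]) + 2) =
        (N : ℤ_[p]) ^ 3 * D.eval (N : ℤ_[p]) := by
  obtain ⟨P, hPd, hP⟩ := exists_polynomial_sPoly (p := p) (x := x) (by omega)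
  obtain ⟨P₂, -, hP₂⟩ := exists_polynomial_sPoly (p := p) (x := x + 2) (by omega)
  obtain ⟨ρ, hρd, hρ⟩ := exists_polynomial_sPoly_sub h
  have hc : (2 * (2 * (x : ℤ_[p]) + 3)) ≠ 0 := by
    have : ((2 * (2 * x + 3) : ℕ) : ℤ_[p]) ≠ 0 := Nat.cast_ne_zero.2 (by omega)
    exact_mod_cast this
  have key : P₂ - P = C (2 * (2 * (x : ℤ_[p]) + 3)) * ρ := by
    refine eq_of_forall_eval_natCast_eq fun n => ?_
    have := hρ n
    simp only [eval_sub, eval_mul, eval_C, hP, hP₂]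
    push_cast
    exact this
  have ρ0 : ρ.eval 0 = 0 := by
    have := hρ 0
    simpa [hc] using this
  have ρ1 : ρ.eval (-1) = 0 := by
    have := congrArg (eval (-1)) key
    rw [eval_sub, eval_neg_one_of_eval_eq_sPoly x (by omega) P hP,
      eval_neg_one_of_eval_eq_sPoly (x + 2) h P₂ hP₂, eval_mul, eval_C] at this
    refine mul_left_cancel₀ hc (this.symm.trans ?_)
    ring
  -- `N² B(N)` is the Christoffel--Darboux boundary term after cancelling `2(2x+3)`; the third
  -- factor `N` comes from `ρ(0) = ρ(-1) = 0`.
  set B := ρ * P.comp (X - 1) - ρ.comp (X - 1) * P with hB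
  have hdX : (X - 1 : ℤ_[p][X]).natDegree = 1 := natDegree_X_sub_C 1
  have hBd : B.natDegree ≤ 2 * x + 2 := by
    have hP' : (P.comp (X - 1)).natDegree ≤ x := by
      rw [natDegree_comp, hdX]; omega
    have hρ' : (ρ.comp (X - 1)).natDegree ≤ x + 2 := by
      rw [natDegree_comp, hdX]; omega
    refine (natDegree_sub_le _ _).trans (max_le ?_ ?_)
    · exact natDegree_mul_le.trans (by omega)
    · exact natDegree_mul_le.trans (by omega)
  have hB0 : B.coeff 0 = 0 := by
    rw [coeff_zero_eq_eval_zero, hB]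
    simp [ρ0, ρ1]
  obtain ⟨D, hD⟩ := X_dvd_iff.2 hB0
  refine ⟨D, ?_, fun N => ?_⟩
  · by_cases hD0 : D = 0
    · simp [hD0]
    · rw [hD, natDegree_mul X_ne_zero hD0, natDegree_X] at hBd
      omega
  · cases N with
    | zero => simp
    | succ N =>
      have e : ((N + 1 : ℕ) : ℤ_[p]) * D.eval ((N + 1 : ℕ) : ℤ_[p]) =
          ρ.eval ((N + 1 : ℕ) : ℤ_[p]) * sPoly N (x : ℤ_[p]) -
            ρ.eval (N : ℤ_[p]) * sPoly (N + 1) (x : ℤ_[p]) := by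
        have := congrArg (eval ((N + 1 : ℕ) : ℤ_[p])) hD
        rw [eval_mul, eval_X] at this
        rw [← this, hB, ← hP, ← hP]
        simp
      have cd := christoffel_darboux N ((x : ℤ_[p]) + 2) x
      refine mul_left_cancel₀ hc ?_
      have h₀ := hρ N
      have h₁ := hρ (N + 1)
      simp only [mul_comm (sPoly _ ((x : ℤ_[p]) + 2))] at cd
      push_cast at *
      linear_combination cd - 2 * (2 * (x : ℤ_[p]) + 3) * ((N : ℤ_[p]) + 1) ^ 2 * e +
        ((N : ℤ_[p]) + 1) ^ 2 * (sPoly N (x : ℤ_[p]) * h₁ - sPoly (N + 1) (x : ℤ_[p]) * h₀)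

/-- The norm `(2x+1) ∑_{n<N} s_n(x)²` agrees with its expected value `(-1)^x N` up to `N³` times a
polynomial in `N`. -/
theorem exists_polynomial_sum_sq (x : ℕ) (h : x + 1 < p) :
    ∃ Q : ℤ_[p][X], Q.natDegree ≤ 2 * x - 1 ∧ ∀ N : ℕ,
      (2 * (x : ℤ_[p]) + 1) * ∑ n ∈ Finset.range N, sPoly n (x : ℤ_[p]) ^ 2 =
        (-1) ^ x * (N : ℤ_[p]) + (N : ℤ_[p]) ^ 3 * Q.eval (N : ℤ_[p]) := by
  induction x using Nat.twoStepInduction with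
  | zero => exact ⟨0, by simp, by simp⟩
  | one =>
    refine ⟨4, by simp, fun N => ?_⟩
    simp only [Nat.cast_one, sPoly_one_right, eval_ofNat]
    induction N with
    | zero => simp
    | succ N ih =>
      rw [Finset.sum_range_succ, mul_add, ih]
      push_cast
      ring
  | more x _ ih =>
    obtain ⟨Q, hQd, hQ⟩ := ih (by omega)
    obtain ⟨D₀, hD₀d, hD₀⟩ := exists_polynomial_sum_mul (p := p) (x := x) (by omega)
    obtain ⟨D₁, hD₁d, hD₁⟩ := exists_polynomial_sum_mul (p := p) (x := x + 1) (by omega)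
    obtain ⟨u, hu⟩ := ((isUnit_natCast_of_pos_of_lt (p := p) (k := x + 2) (by omega)
      (by omega)).pow 2).exists_left_inv
    refine ⟨C u * (C (-(x + 2) ^ 2 : ℤ_[p]) * Q +
      C ((2 * x + 3) * (x + 3) ^ 2 : ℤ_[p]) * D₁ +
      C ((2 * x + 5) * (x + 1) ^ 2 : ℤ_[p]) * D₀), ?_, fun N => ?_⟩
    · refine (natDegree_C_mul_le _ _).trans ?_
      refine natDegree_add_le_of_degree_le (natDegree_add_le_of_degree_le ?_ ?_) ?_ <;>
        exact (natDegree_C_mul_le _ _).trans (by omega)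
    · have r := sum_sq_recurrence N (x : ℤ_[p])
      have hQ := hQ N
      have hD₀ := hD₀ N
      have hD₁ := hD₁ N
      push_cast at hQ hD₁ hu ⊢
      rw [show (x : ℤ_[p]) + 1 + 2 = x + 3 by ring] at hD₁
      have hx : ((x : ℤ_[p]) + 2) ^ 2 ≠ 0 := fun h0 => by simp [h0] at hu
      refine mul_left_cancel₀ hx ?_
      simp only [eval_add, eval_mul, eval_C]
      linear_combination r - ((x : ℤ_[p]) + 2) ^ 2 * hQ +
        (2 * x + 3) * ((x : ℤ_[p]) + 3) ^ 2 * hD₁ + (2 * x + 5) * ((x : ℤ_[p]) + 1) ^ 2 * hD₀ -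
        (N : ℤ_[p]) ^ 3 * (-((x : ℤ_[p]) + 2) ^ 2 * Q.eval (N : ℤ_[p]) +
          (2 * x + 3) * ((x : ℤ_[p]) + 3) ^ 2 * D₁.eval (N : ℤ_[p]) +
          (2 * x + 5) * ((x : ℤ_[p]) + 1) ^ 2 * D₀.eval (N : ℤ_[p])) * hu

end Polynomial

/-! ### Congruences at the integers `0 ≤ x < p` -/

section Congruence

open Polynomial

variable {p : ℕ} [Fact p.Prime]

theorem isUnit_of_not_dvd {a : ℤ_[p]} (h : ¬ (p : ℤ_[p]) ∣ a) : IsUnit a := by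
  by_contra hu
  exact h ((PadicInt.norm_lt_one_iff_dvd a).1 (PadicInt.not_isUnit_iff.1 hu))

theorem isUnit_two (hp : 3 < p) : IsUnit (2 : ℤ_[p]) := by
  exact_mod_cast isUnit_natCast_of_pos_of_lt (p := p) (k := 2) (by omega) (by omega)

theorem isUnit_two_mul_add_one {x : ℕ} (hx : x < p) (h : 2 * x + 1 ≠ p) :
    IsUnit (2 * (x : ℤ_[p]) + 1) := by
  have : IsUnit ((2 * x + 1 : ℕ) : ℤ_[p]) := by
    rw [PadicInt.isUnit_iff, PadicInt.norm_natCast_eq_one_iff,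
      Nat.Prime.coprime_iff_not_dvd Fact.out]
    rintro ⟨c, hc⟩
    have h1 : c < 2 := by
      by_contra! h2
      nlinarith
    interval_cases c <;> omega
  exact_mod_cast this

theorem dvd_sPoly_self_sub_one {x : ℕ} (h : x < p) :
    (p : ℤ_[p]) ∣ sPoly p (x : ℤ_[p]) - 1 := by
  obtain ⟨P, -, hP⟩ := exists_polynomial_sPoly h
  have := sub_dvd_eval_sub (p : ℤ_[p]) ((0 : ℕ) : ℤ_[p]) P
  rwa [hP, hP, sPoly_zero_left, Nat.cast_zero, sub_zero] at this

/-- Here `p - 1` is congruent to `-1`, where the interpolating polynomial takes the value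
`(-1)^x`. -/
theorem dvd_sPoly_pred_sub {x : ℕ} (h : x < p) :
    (p : ℤ_[p]) ∣ sPoly (p - 1) (x : ℤ_[p]) - (-1) ^ x := by
  obtain ⟨P, -, hP⟩ := exists_polynomial_sPoly h
  have := sub_dvd_eval_sub ((p - 1 : ℕ) : ℤ_[p]) (-1) P
  rw [hP, eval_neg_one_of_eval_eq_sPoly x h P hP, Nat.cast_sub (by omega)] at this
  simpa using this

/-- At the middle point `x = (p-1)/2`, the error polynomial of `exists_polynomial_sum_sq` is
`∓ X^(p-3)` modulo `p`, so its value at `p` is divisible by `p`. -/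
theorem dvd_eval_error (hp : 3 < p) {x : ℕ} (h : 2 * x + 1 = p) {Q : ℤ_[p][X]}
    (hd : Q.natDegree ≤ 2 * x - 1)
    (hQ : ∀ N : ℕ, (2 * (x : ℤ_[p]) + 1) * ∑ n ∈ Finset.range N, sPoly n (x : ℤ_[p]) ^ 2 =
        (-1) ^ x * (N : ℤ_[p]) + (N : ℤ_[p]) ^ 3 * Q.eval (N : ℤ_[p])) :
    (p : ℤ_[p]) ∣ Q.eval (p : ℤ_[p]) := by
  have hx : 2 * (x : ℤ_[p]) + 1 = (p : ℤ_[p]) := by exact_mod_cast congrArg Nat.cast h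
  -- The left side of `hQ` vanishes modulo `p`, so `Q(a) = -(-1)^x a⁻² = -(-1)^x a^(p-3)` for all
  -- nonzero residues `a`, and the degree bound turns this into an identity of polynomials.
  set φ : ℤ_[p] →+* ZMod p := PadicInt.toZMod with hφ
  have hval : ∀ a : ZMod p, (-1) ^ x * a + a ^ 3 * (Q.map φ).eval a = 0 := by
    intro a
    have := congrArg φ (hQ a.val)
    rw [hx] at this
    simp only [map_mul, map_add, map_pow, map_neg, map_one, map_natCast,
      CharP.cast_eq_zero, zero_mul, ZMod.natCast_zmod_val] at this
    rw [this]
    congr 2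
    conv_lhs => rw [← ZMod.natCast_zmod_val a, ← map_natCast φ, eval_map_apply]
  have hg : Q.map φ + C ((-1) ^ x) * X ^ (p - 3) = 0 := by
    refine eq_zero_of_natDegree_lt_card_of_eval_eq_zero' _
      ((Finset.univ : Finset (ZMod p)).erase 0) (fun a ha => ?_) ?_
    · have ha : a ≠ 0 := Finset.ne_of_mem_erase ha
      refine mul_left_cancel₀ (pow_ne_zero 3 ha) ?_
      have hpow : a ^ 3 * a ^ (p - 3) = a := by
        rw [← pow_add, Nat.add_sub_cancel' hp.le, ZMod.pow_card]
      simp only [eval_add, eval_mul, eval_C, eval_pow, eval_X]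
      linear_combination hval a + (-1) ^ x * hpow
    · rw [Finset.card_erase_of_mem (Finset.mem_univ _), Finset.card_univ, ZMod.card]
      refine lt_of_le_of_lt (natDegree_add_le_of_degree_le (n := p - 2) ?_ ?_) (by omega)
      · exact natDegree_map_le.trans (by omega)
      · exact (natDegree_C_mul_X_pow_le _ _).trans (by omega)
  have h0 := congrArg (eval 0) hg
  rw [← Ideal.mem_span_singleton, ← PadicInt.maximalIdeal_eq_span_p, ← PadicInt.ker_toZMod,
    RingHom.mem_ker, ← hφ, ← eval_map_apply, map_natCast, CharP.cast_eq_zero]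
  simpa [show p - 3 ≠ 0 by omega] using h0

/-- The supercongruence for `∑ s_n(x)²` modulo `p³`, in a form without denominators. -/
theorem sum_sq_congr (hp : 3 < p) {x : ℕ} (h : x < p) :
    (2 * (x : ℤ_[p]) + 1) * (p : ℤ_[p]) ^ 3 ∣
      (2 * (x : ℤ_[p]) + 1) * ∑ n ∈ Finset.range p, sPoly n (x : ℤ_[p]) ^ 2 -
        (-1) ^ x * (p : ℤ_[p]) := by
  by_cases hmid : 2 * x + 1 = p
  · obtain ⟨Q, hQd, hQ⟩ := exists_polynomial_sum_sq (p := p) x (by omega)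
    obtain ⟨c, hc⟩ := dvd_eval_error hp hmid hQd hQ
    have hx : 2 * (x : ℤ_[p]) + 1 = (p : ℤ_[p]) := by exact_mod_cast congrArg Nat.cast hmid
    refine ⟨c, ?_⟩
    rw [hQ p, hc, hx]
    ring
  · rw [(isUnit_two_mul_add_one h hmid).mul_left_dvd]
    rcases Nat.lt_or_ge (x + 1) p with h1 | h1
    · obtain ⟨Q, -, hQ⟩ := exists_polynomial_sum_sq (p := p) x h1
      rw [hQ p, add_sub_cancel_left]
      exact Dvd.intro _ rfl
    · -- At `x = p - 1` the polynomial for `s_n(x+1)` is not `p`-integral. One more step of the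
      -- recurrence still works: the sum of `s_n(p-2) s_n(p)` carries the coefficient `p²`, and is
      -- itself divisible by `p`.
      obtain ⟨y, rfl⟩ : ∃ y, x = y + 2 := ⟨x - 2, by omega⟩
      obtain rfl : p = y + 3 := by omega
      set q : ℤ_[y + 3] := ((y + 3 : ℕ) : ℤ_[y + 3]) with hq
      have hq' : q = (y : ℤ_[y + 3]) + 3 := by rw [hq]; push_cast; rfl
      obtain ⟨Q, -, hQ⟩ := exists_polynomial_sum_sq (p := y + 3) (y + 1) (by omega)
      obtain ⟨D, -, hD⟩ := exists_polynomial_sum_mul (p := y + 3) (x := y) (by omega)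
      have hQ := hQ (y + 3)
      have hD := hD (y + 3)
      have r := sum_sq_recurrence (y + 3) (y : ℤ_[y + 3])
      have cd := christoffel_darboux (y + 2) ((y : ℤ_[y + 3]) + 3) (y + 1)
      obtain ⟨u, hu⟩ := ((isUnit_natCast_of_pos_of_lt (p := y + 3) (k := y + 2) (by omega)
        (by omega)).pow 2)
      obtain ⟨v, hv⟩ : IsUnit (2 * (2 * ((y : ℤ_[y + 3]) + 1) + 3)) := by
        refine IsUnit.mul ?_ ?_
        · exact_mod_cast isUnit_natCast_of_pos_of_lt (p := y + 3) (k := 2) (by omega) (by omega)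
        · have := isUnit_two_mul_add_one h hmid
          push_cast at this
          convert this using 1
          ring
      have hE : q ∣ ∑ n ∈ Finset.range (y + 3),
          sPoly n ((y : ℤ_[y + 3]) + 1) * sPoly n ((y : ℤ_[y + 3]) + 3) := by
        rw [← v.isUnit.dvd_mul_left, hv]
        simp only [mul_comm (sPoly _ ((y : ℤ_[y + 3]) + 1))]
        rw [show (2 * (2 * ((y : ℤ_[y + 3]) + 1) + 3)) =
          ((y : ℤ_[y + 3]) + 3) * (y + 3 + 1) - (y + 1) * (y + 1 + 1) by ring]
        rw [cd]
        refine Dvd.dvd.mul_right (Dvd.dvd.trans ?_ (dvd_pow_self _ two_ne_zero)) _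
        rw [hq']
        exact dvd_of_eq (by push_cast; ring)
      obtain ⟨E, hE⟩ := hE
      rw [← u.isUnit.dvd_mul_left, hu]
      rw [← hq] at hQ hD
      rw [hE, hD] at r
      push_cast at hQ r ⊢
      refine ⟨-((y : ℤ_[y + 3]) + 2) ^ 2 * Q.eval q + (2 * y + 3) * E +
        (2 * y + 5) * (y + 1) ^ 2 * D.eval q, ?_⟩
      linear_combination r - ((y : ℤ_[y + 3]) + 2) ^ 2 * hQ -
        (2 * y + 3) * (q + y + 3) * q * E * hq'

/-- By Christoffel--Darboux, `2(2x+1) ∑ (2n+1) s_n(x)²` is `p²` times a difference of two boundary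
terms; modulo `p` that difference is `2(-1)^x (2x+1)`, which supplies the missing factor `p` at
`x = (p-1)/2`. -/
theorem sum_weighted_sq_congr (hp : 3 < p) {x : ℕ} (h : x < p) :
    (p : ℤ_[p]) ^ 2 ∣ ∑ n ∈ Finset.range p, (2 * (n : ℤ_[p]) + 1) * sPoly n (x : ℤ_[p]) ^ 2 := by
  obtain ⟨q, hq⟩ : ∃ q, p = q + 1 := ⟨p - 1, by omega⟩
  set B : ℤ_[p] → ℤ_[p] := fun z =>
    sPoly p (z + 1) * sPoly (p - 1) z - sPoly (p - 1) (z + 1) * sPoly p z with hB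
  have hW : ∀ z : ℤ_[p], 2 * (z + 1) * ∑ n ∈ Finset.range p, sPoly n (z + 1) * sPoly n z =
      (p : ℤ_[p]) ^ 2 * B z := by
    intro z
    have cd := christoffel_darboux q (z + 1) z
    rw [← hq, show q = p - 1 by omega, Nat.cast_sub (by omega)] at cd
    push_cast at cd
    rw [sub_add_cancel] at cd
    rw [hB, ← cd]
    ring
  cases x with
  | zero =>
    have hsq : ∀ N : ℕ, ∑ n ∈ Finset.range N, (2 * (n : ℤ_[p]) + 1) = (N : ℤ_[p]) ^ 2 := by
      intro N
      induction N with
      | zero => simp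
      | succ N ih =>
        rw [Finset.sum_range_succ, ih]
        push_cast
        ring
    simp [hsq]
  | succ x =>
    have key := sum_weighted_sq p (x : ℤ_[p])
    have h₀ := hW x
    have h₁ := hW (x + 1)
    rw [show (x : ℤ_[p]) + 1 + 1 = x + 2 by ring] at h₁
    have main : 2 * (2 * (x : ℤ_[p]) + 3) *
        ∑ n ∈ Finset.range p, (2 * (n : ℤ_[p]) + 1) * sPoly n ((x : ℤ_[p]) + 1) ^ 2 =
        (p : ℤ_[p]) ^ 2 * ((x + 2) * B (x + 1) - (x + 1) * B x) := by
      linear_combination 2 * key + ((x : ℤ_[p]) + 2) * h₁ - ((x : ℤ_[p]) + 1) * h₀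
    push_cast
    by_cases hmid : 2 * (x + 1) + 1 = p
    · have hx : 2 * (x : ℤ_[p]) + 3 = (p : ℤ_[p]) := by
        have := congrArg (Nat.cast (R := ℤ_[p])) hmid
        push_cast at this
        linear_combination this
      obtain ⟨a₀, ha₀⟩ := dvd_sPoly_self_sub_one (p := p) (x := x) (by omega)
      obtain ⟨a₁, ha₁⟩ := dvd_sPoly_self_sub_one (p := p) (x := x + 1) (by omega)
      obtain ⟨a₂, ha₂⟩ := dvd_sPoly_self_sub_one (p := p) (x := x + 2) (by omega)
      obtain ⟨b₀, hb₀⟩ := dvd_sPoly_pred_sub (p := p) (x := x) (by omega)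
      obtain ⟨b₁, hb₁⟩ := dvd_sPoly_pred_sub (p := p) (x := x + 1) (by omega)
      obtain ⟨b₂, hb₂⟩ := dvd_sPoly_pred_sub (p := p) (x := x + 2) (by omega)
      push_cast at ha₁ ha₂ hb₁ hb₂
      have hB₀ : (p : ℤ_[p]) ∣ B x - 2 * (-1) ^ x := by
        rw [hB]
        dsimp only
        rw [sub_eq_iff_eq_add.1 ha₀, sub_eq_iff_eq_add.1 ha₁, sub_eq_iff_eq_add.1 hb₀,
          sub_eq_iff_eq_add.1 hb₁]
        exact ⟨p * a₁ * b₀ + b₀ + a₁ * (-1) ^ x - (p * b₁ * a₀ + b₁ - (-1) ^ x * a₀), by ring⟩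
      have hB₁ : (p : ℤ_[p]) ∣ B (x + 1) + 2 * (-1) ^ x := by
        rw [hB]
        dsimp only
        rw [show (x : ℤ_[p]) + 1 + 1 = x + 2 by ring]
        rw [sub_eq_iff_eq_add.1 ha₁, sub_eq_iff_eq_add.1 ha₂, sub_eq_iff_eq_add.1 hb₁,
          sub_eq_iff_eq_add.1 hb₂]
        exact ⟨p * a₂ * b₁ + b₁ - a₂ * (-1) ^ x - (p * b₂ * a₁ + b₂ + (-1) ^ x * a₁), by ring⟩
      obtain ⟨c₀, hc₀⟩ := hB₀
      obtain ⟨c₁, hc₁⟩ := hB₁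
      rw [← (isUnit_two hp).dvd_mul_left]
      refine ⟨(x + 2) * c₁ - (x + 1) * c₀ - 2 * (-1) ^ x, ?_⟩
      refine mul_left_cancel₀ (Nat.cast_ne_zero.2 (by omega) : (p : ℤ_[p]) ≠ 0) ?_
      rw [hx] at main
      linear_combination main + (p : ℤ_[p]) ^ 2 * ((x + 2) * hc₁ - (x + 1) * hc₀) -
        2 * (-1) ^ x * (p : ℤ_[p]) ^ 2 * hx
    · have hu := isUnit_two_mul_add_one h hmid
      push_cast at hu
      rw [show 2 * ((x : ℤ_[p]) + 1) + 1 = 2 * x + 3 by ring] at hu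
      rw [← ((isUnit_two hp).mul hu).dvd_mul_left, main]
      exact Dvd.intro _ rfl

/-! ### From integers to `p`-adic integers -/

theorem exists_polynomial_legendreCoeff {k : ℕ} (h : k < p) :
    ∃ A : ℤ_[p][X], ∀ x : ℤ_[p], legendreCoeff k x = A.eval (x * (x + 1)) := by
  induction k with
  | zero => exact ⟨1, by simp⟩
  | succ k ih =>
    obtain ⟨A, hA⟩ := ih (by omega)
    obtain ⟨u, hu⟩ := ((isUnit_natCast_of_pos_of_lt k.succ_pos h).pow 2).exists_left_inv
    refine ⟨C u * (X - C ((k : ℤ_[p]) * (k + 1))) * A, fun x => ?_⟩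
    have := sq_mul_legendreCoeff_succ x k
    push_cast at hu
    simp only [eval_mul, eval_C, eval_sub, eval_X, ← hA]
    linear_combination u * this - legendreCoeff (k + 1) x * hu

theorem exists_polynomial_sPoly_left {n : ℕ} (h : n < p) :
    ∃ A : ℤ_[p][X], ∀ x : ℤ_[p], sPoly n x = A.eval (x * (x + 1)) := by
  have hA : ∀ k : ℕ, ∃ A : ℤ_[p][X], k < p →
      ∀ x : ℤ_[p], legendreCoeff k x = A.eval (x * (x + 1)) := fun k => by
    by_cases hk : k < p
    · exact (exists_polynomial_legendreCoeff hk).imp fun _ h _ => h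
    · exact ⟨0, fun h => absurd h hk⟩
  choose A hA using hA
  refine ⟨∑ k ∈ Finset.range (n + 1), C (n.choose k : ℤ_[p]) * A k, fun x => ?_⟩
  rw [sPoly_eq_sum, eval_finsetSum]
  refine Finset.sum_congr rfl fun k hk => ?_
  rw [Finset.mem_range] at hk
  rw [eval_mul, eval_C, hA k (by omega)]

/-- A `p`-integral weighted sum of the squares `s_n(x)²`, `n < p`, is a polynomial in `x(x+1)` with
coefficients in `ℤ_[p]`. -/
theorem exists_polynomial_sum_mul_sq (c : ℕ → ℤ_[p]) :
    ∃ f : ℤ_[p][X], ∀ x : ℤ_[p],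
      ∑ n ∈ Finset.range p, c n * sPoly n x ^ 2 = f.eval (x * (x + 1)) := by
  have hA : ∀ n : ℕ, ∃ A : ℤ_[p][X], n < p →
      ∀ x : ℤ_[p], sPoly n x = A.eval (x * (x + 1)) := fun n => by
    by_cases hn : n < p
    · exact (exists_polynomial_sPoly_left hn).imp fun _ h _ => h
    · exact ⟨0, fun h => absurd h hn⟩
  choose A hA using hA
  refine ⟨∑ n ∈ Finset.range p, C (c n) * A n ^ 2, fun x => ?_⟩
  rw [eval_finsetSum]
  refine Finset.sum_congr rfl fun n hn => ?_
  rw [eval_mul, eval_C, eval_pow, hA n (Finset.mem_range.1 hn)]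

/-- Modulo `p²`, a polynomial in `x(x+1)` on the residue class of `r` is determined by its values
at `r` and at `p - 1 - r`: the latter is `-1 - (r - p)`, the mirror image of a point of the class. -/
theorem eval_congr_of_reflection (f : ℤ_[p][X]) (r t : ℤ_[p]) :
    (p : ℤ_[p]) ^ 2 ∣ f.eval ((r + p * t) * (r + p * t + 1)) -
      ((1 + t) * f.eval (r * (r + 1)) - t * f.eval ((p - 1 - r) * (p - 1 - r + 1))) := by
  obtain ⟨a, ha⟩ := f.binomExpansion (r * (r + 1)) (p * (t * (2 * r + 1) + p * t ^ 2))
  obtain ⟨b, hb⟩ := f.binomExpansion (r * (r + 1)) (p * (p - (2 * r + 1)))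
  rw [show (r + p * t) * (r + p * t + 1) =
      r * (r + 1) + p * (t * (2 * r + 1) + p * t ^ 2) by ring, ha,
    show ((p : ℤ_[p]) - 1 - r) * (p - 1 - r + 1) = r * (r + 1) + p * (p - (2 * r + 1)) by ring, hb]
  exact ⟨(derivative f).eval (r * (r + 1)) * (t ^ 2 + t) +
    a * (t * (2 * r + 1) + p * t ^ 2) ^ 2 + t * b * (p - (2 * r + 1)) ^ 2, by ring⟩

/-- The values at `r` and at `p - 1 - r`, known from `sum_sq_congr`, are both divisible by `p`, and
`2(p-1-r)+1` is congruent to `-(2r+1)`; so both are known modulo `p²`. -/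
theorem sum_sq_congr_padic (hp : 3 < p) {r : ℕ} (h : r < p) (hmid : 2 * r + 1 ≠ p) (t : ℤ_[p]) :
    (p : ℤ_[p]) ^ 2 ∣ (2 * ((r : ℤ_[p]) + p * t) + 1) *
        ∑ n ∈ Finset.range p, sPoly n ((r : ℤ_[p]) + p * t) ^ 2 -
      (-1) ^ r * (p + 2 * (p * t)) := by
  obtain ⟨f, hf⟩ := exists_polynomial_sum_mul_sq (p := p) fun _ => 1
  simp only [one_mul] at hf
  obtain ⟨c, hc⟩ := eval_congr_of_reflection f r t
  have e : (p : ℤ_[p]) - 1 - r = ((p - 1 - r : ℕ) : ℤ_[p]) := by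
    rw [Nat.cast_sub (by omega), Nat.cast_sub (by omega), Nat.cast_one]
  have hsgn : (-1 : ℤ_[p]) ^ (p - 1 - r) = (-1) ^ r := by
    have hodd : Odd p := (Fact.out : p.Prime).odd_of_ne_two (by omega)
    rw [← mul_one ((-1 : ℤ_[p]) ^ r), neg_one_pow_congr (n := r), mul_one]
    obtain ⟨m, hm⟩ := hodd
    simp only [Nat.even_iff]
    omega
  rw [← hf, ← hf, e, ← hf] at hc
  set S := ∑ n ∈ Finset.range p, sPoly n ((r : ℤ_[p]) + p * t) ^ 2
  have h₀ := sum_sq_congr hp h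
  have h₁ := sum_sq_congr hp (show p - 1 - r < p by omega)
  rw [(isUnit_two_mul_add_one h hmid).mul_left_dvd] at h₀
  have hu := isUnit_two_mul_add_one (p := p) (x := p - 1 - r) (by omega) (by omega)
  rw [hu.mul_left_dvd, hsgn] at h₁
  set S₀ := ∑ n ∈ Finset.range p, sPoly n (r : ℤ_[p]) ^ 2
  set S₁ := ∑ n ∈ Finset.range p, sPoly n ((p - 1 - r : ℕ) : ℤ_[p]) ^ 2
  obtain ⟨a, ha⟩ := h₀
  obtain ⟨b, hb⟩ := h₁
  have hpS₀ : (p : ℤ_[p]) ∣ S₀ := by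
    rw [← (isUnit_two_mul_add_one h hmid).dvd_mul_left]
    exact ⟨p ^ 2 * a + (-1) ^ r, by linear_combination ha⟩
  have hpS₁ : (p : ℤ_[p]) ∣ S₁ := by
    rw [← hu.dvd_mul_left]
    exact ⟨p ^ 2 * b + (-1) ^ r, by linear_combination hb⟩
  obtain ⟨a', ha'⟩ := hpS₀
  obtain ⟨b', hb'⟩ := hpS₁
  rw [← e] at hb
  refine ⟨(2 * r + 1 + 2 * p * t) * c + 2 * t * ((1 + t) * a' - t * b') + (1 + t) * p * a +
    t * p * b - 2 * t * b', ?_⟩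
  linear_combination (2 * (r : ℤ_[p]) + 1 + 2 * p * t) * hc +
    2 * p * t * ((1 + t) * ha' - t * hb') + (1 + t) * ha + t * hb - 2 * t * p * hb'

theorem sum_weighted_sq_congr_padic (hp : 3 < p) {r : ℕ} (h : r < p) (t : ℤ_[p]) :
    (p : ℤ_[p]) ^ 2 ∣
      ∑ n ∈ Finset.range p, (2 * (n : ℤ_[p]) + 1) * sPoly n ((r : ℤ_[p]) + p * t) ^ 2 := by
  obtain ⟨f, hf⟩ := exists_polynomial_sum_mul_sq (p := p) fun n => 2 * (n : ℤ_[p]) + 1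
  have hc := eval_congr_of_reflection f r t
  have e : (p : ℤ_[p]) - 1 - r = ((p - 1 - r : ℕ) : ℤ_[p]) := by
    rw [Nat.cast_sub (by omega), Nat.cast_sub (by omega), Nat.cast_one]
  rw [← hf, ← hf, e, ← hf] at hc
  refine (dvd_sub_left ?_).1 hc
  exact dvd_sub ((sum_weighted_sq_congr hp h).mul_left _)
    ((sum_weighted_sq_congr hp (show p - 1 - r < p by omega)).mul_left _)

/-! ### Translation to congruences in `ℚ_[p]` -/

theorem padicCongr_div_of_dvd {m : ℕ} {a b d : ℤ_[p]} (hd : d ≠ 0)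
    (h : d * (p : ℤ_[p]) ^ m ∣ d * a - b) :
    PadicCongr p m (a : ℚ_[p]) ((b : ℚ_[p]) / (d : ℚ_[p])) := by
  obtain ⟨z, hz⟩ := h
  have hd' : (d : ℚ_[p]) ≠ 0 := PadicInt.coe_ne_zero.2 hd
  refine ⟨z, ?_⟩
  have hz' : (d : ℚ_[p]) * a - b = d * (p : ℚ_[p]) ^ m * z := by
    exact_mod_cast congrArg ((↑) : ℤ_[p] → ℚ_[p]) hz
  field_simp
  linear_combination hz'

theorem leastResidue_lt_and_exists_eq (x : ℤ_[p]) :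
    leastResidue p x < p ∧ ∃ t : ℤ_[p], x = (leastResidue p x : ℤ_[p]) + p * t := by
  have hset : ∀ r : ℕ, PadicCongr p 1 (x : ℚ_[p]) (r : ℚ_[p]) ↔
      ∃ t : ℤ_[p], x = (r : ℤ_[p]) + p * t := fun r => by
    refine exists_congr fun z => ?_
    rw [pow_one, sub_eq_iff_eq_add']
    exact ⟨fun h => PadicInt.ext h, fun h => congrArg ((↑) : ℤ_[p] → ℚ_[p]) h⟩
  obtain ⟨n, hn, hx⟩ := PadicInt.exists_mem_range x
  rw [PadicInt.maximalIdeal_eq_span_p, Ideal.mem_span_singleton] at hx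
  obtain ⟨t, ht⟩ := hx
  have hmem : n ∈ {r : ℕ | PadicCongr p 1 (x : ℚ_[p]) (r : ℚ_[p])} :=
    (hset n).2 ⟨t, by linear_combination ht⟩
  exact ⟨(Nat.sInf_le hmem).trans_lt hn, (hset _).1 (Nat.sInf_mem ⟨n, hmem⟩)⟩

end Congruence

theorem theorem1p4 (p : ℕ) [Fact p.Prime] (hp : 3 < p) :
    (∀ x : ℤ_[p], ¬ PadicCongr p 1 (x : ℚ_[p]) (-1 / 2) →
      PadicCongr p 2 (∑ k ∈ Finset.range p, ((sPoly k x : ℤ_[p]) : ℚ_[p]) ^ 2)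
        ((-1) ^ leastResidue p x *
          (((p : ℚ_[p]) + 2 * ((x : ℚ_[p]) - (leastResidue p x : ℚ_[p]))) /
            (2 * (x : ℚ_[p]) + 1)))) ∧
    (∀ x : ℕ, x < p →
      PadicCongr p 3 (∑ k ∈ Finset.range p, ((sPoly k (x : ℤ_[p]) : ℤ_[p]) : ℚ_[p]) ^ 2)
        ((-1) ^ x * (p : ℚ_[p]) / (2 * (x : ℚ_[p]) + 1))) ∧
    (∀ x : ℤ_[p],
      PadicCongr p 2
        (∑ k ∈ Finset.range p, (2 * (k : ℚ_[p]) + 1) * ((sPoly k x : ℤ_[p]) : ℚ_[p]) ^ 2) 0) := by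
  refine ⟨fun x hx => ?_, fun x hx => ?_, fun x => ?_⟩
  · obtain ⟨hr, t, ht⟩ := leastResidue_lt_and_exists_eq x
    generalize leastResidue p x = r at *
    have hmid : 2 * r + 1 ≠ p := by
      intro hmid
      obtain ⟨u, hu⟩ := (isUnit_two (p := p) hp).exists_right_inv
      apply hx
      have hd := padicCongr_div_of_dvd (p := p) (m := 1) (a := x) (b := -1) (d := 2) two_ne_zero
        ⟨u * (1 + 2 * t), by
          have hr' : 2 * (r : ℤ_[p]) + 1 = (p : ℤ_[p]) := by exact_mod_cast congrArg Nat.cast hmid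
          rw [ht]
          linear_combination hr' - (p : ℤ_[p]) * (1 + 2 * t) * hu⟩
      simp only [PadicInt.coe_neg, PadicInt.coe_one] at hd
      exact hd
    have hunit : IsUnit (2 * x + 1) := by
      refine isUnit_of_not_dvd fun hd => ?_
      have h2 : (p : ℤ_[p]) ∣ 2 * (r : ℤ_[p]) + 1 := by
        obtain ⟨c, hc⟩ := hd
        exact ⟨c - 2 * t, by linear_combination hc - 2 * ht⟩
      exact PadicInt.prime_p.not_isUnit
        (isUnit_of_dvd_unit h2 (isUnit_two_mul_add_one hr hmid))
    have hd := sum_sq_congr_padic hp hr hmid t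
    rw [← ht, ← hunit.mul_left_dvd] at hd
    have := padicCongr_div_of_dvd hunit.ne_zero hd
    rw [show (p : ℤ_[p]) * t = x - r by linear_combination -ht] at this
    rw [← mul_div_assoc]
    simp only [PadicInt.coe_sum] at this
    push_cast at this
    exact this
  · have hne : 2 * (x : ℤ_[p]) + 1 ≠ 0 := by
      have : ((2 * x + 1 : ℕ) : ℤ_[p]) ≠ 0 := Nat.cast_ne_zero.2 (by omega)
      exact_mod_cast this
    have := padicCongr_div_of_dvd hne (sum_sq_congr hp hx)
    simp only [PadicInt.coe_sum] at this
    push_cast at this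
    exact this
  · obtain ⟨hr, t, ht⟩ := leastResidue_lt_and_exists_eq x
    obtain ⟨c, hc⟩ := sum_weighted_sq_congr_padic hp hr t
    rw [← ht] at hc
    refine ⟨c, ?_⟩
    have := congrArg ((↑) : ℤ_[p] → ℚ_[p]) hc
    simp only [PadicInt.coe_sum, PadicInt.coe_mul, PadicInt.coe_add] at this
    push_cast at this
    rwa [sub_zero]
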